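/- Let $0\le k<n$ and let $h=(h_1,\dots,h_k)$ with $h_j\in\mathbb{R}[x_1,\dots,x_n]$. Let $V=V_{\mathbb R}(h)=\{x\in\mathbb{R}^n : h(x)=0\}$ and let $\mathcal J(x)=(\partial h_j/\partial x_i(x))_{j,i}$ be the $k\times n$ Jacobian matrix. Assume that $V\neq\emptyset$ and that $\mathcal J(x)$ has rank $k$ at every $x\in V$. Then $V$ is an embedded smooth submanifold of $\mathbb{R}^n$ of dimension $n-k$, and $V$ has a tubular neighborhood $U$ such that the following holds for every $b\in U$: (1) there is a unique point $x_b\in V$ of minimum Euclidean distance to $b$; (2) there is $\lambda_b\in\mathbb{R}^k$ such that $(x_b,\lambda_b)$ is an isolated and simple zero of the Lagrange system $$x-b=\mathcal J(x)^{t}\lambda,\qquad h(x)=0$$ of the problem $\min \|x-b\|_2^2/2$ subject to $h(x)=0$, and $(x_b,\lambda_b)$ is the only zero of this system, real or complex, whose $x$-component is $x_b$. Here a tubular neighborhood of $V$ is an open set $U\supseteq V$ that is the diffeomorphic image, under $E(x,v)=x+v$, of a set $\{(x,v)\in NV : \|v\|_2<\delta(x)\}$ for some positive continuous function $\delta:V\to\mathbb{R}$,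 where $NV=\{(x,v): x\in V,\ v\perp T_xV\}$ is the normal bundle of $V$. The zero is isolated if it has a neighborhood in $\mathbb{C}^{n}\times\mathbb{C}^{k}$ (hence also one in $\mathbb{R}^n\times\mathbb{R}^k$) that contains no other zero of the system, and simple if the $(n+k)\times(n+k)$ Jacobian matrix of the system with respect to $(x,\lambda)$ is nonsingular there. -/

import Mathlib

open scoped ContDiff

namespace TubularLagrange

section Smooth

variable {X Y : Type*} [NormedAddCommGroup X] [NormedSpace ℝ X]
  [NormedAddCommGroup Y] [NormedSpace ℝ Y]

/-- Smoothness of a map on an arbitrary subset `A` of a normed space: near every point of `A`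
it agrees on `A` with a smooth map defined on an open subset of the ambient space. -/
def SmoothOnSubset (f : X → Y) (A : Set X) : Prop :=
  ∀ x ∈ A, ∃ O : Set X, IsOpen O ∧ x ∈ O ∧
    ∃ g : X → Y, ContDiffOn ℝ ∞ g O ∧ Set.EqOn f g (A ∩ O)

/-- `f` restricts to a diffeomorphism from the subset `A` onto the subset `B`. -/
def IsDiffeoOnto (f : X → Y) (A : Set X) (B : Set Y) : Prop :=
  Set.BijOn f A B ∧ SmoothOnSubset f A ∧
    ∃ g : Y → X, Set.InvOn g f A B ∧ SmoothOnSubset g B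

end Smooth

section Submanifold

variable {n : ℕ}

/-- `M` is an embedded smooth submanifold of dimension `d` of `ℝⁿ`: around each of its points
there is a smooth chart of `ℝⁿ` that carries `M` to a `d`-dimensional linear slice. -/
def IsEmbeddedSubmanifold (d : ℕ) (M : Set (EuclideanSpace ℝ (Fin n))) : Prop :=
  ∀ x ∈ M, ∃ φ : OpenPartialHomeomorph (EuclideanSpace ℝ (Fin n)) (EuclideanSpace ℝ (Fin n)),
    x ∈ φ.source ∧ ContDiffOn ℝ ∞ φ φ.source ∧ ContDiffOn ℝ ∞ φ.symm φ.target ∧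
    ∃ W : Submodule ℝ (EuclideanSpace ℝ (Fin n)), Module.finrank ℝ W = d ∧
      ∀ y ∈ φ.source, y ∈ M ↔ φ y ∈ W

/-- Tangent vectors to `M` at `x`: velocities at time `0` of smooth curves in `M` through `x`. -/
def tangentVectors (M : Set (EuclideanSpace ℝ (Fin n))) (x : EuclideanSpace ℝ (Fin n)) :
    Set (EuclideanSpace ℝ (Fin n)) :=
  {v | ∃ (ε : ℝ) (γ : ℝ → EuclideanSpace ℝ (Fin n)), 0 < ε ∧
    ContDiffOn ℝ ∞ γ (Set.Ioo (-ε) ε) ∧ (∀ t ∈ Set.Ioo (-ε) ε, γ t ∈ M) ∧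
    γ 0 = x ∧ HasDerivAt γ v 0}

/-- The normal bundle of `M`: the pairs `(x, v)` with `x ∈ M` and `v` orthogonal to every
tangent vector of `M` at `x`. -/
def normalBundle (M : Set (EuclideanSpace ℝ (Fin n))) :
    Set (EuclideanSpace ℝ (Fin n) × EuclideanSpace ℝ (Fin n)) :=
  {p | p.1 ∈ M ∧ ∀ w ∈ tangentVectors M p.1, inner ℝ p.2 w = 0}

/-- `U` is a tubular neighborhood of `M`: an open neighborhood of `M` that is the diffeomorphic
image under `(x, v) ↦ x + v` of `{(x, v) ∈ NM | ‖v‖ < δ x}`, for some positive continuous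
function `δ` on `M`. -/
def IsTubularNeighborhood (M U : Set (EuclideanSpace ℝ (Fin n))) : Prop :=
  IsOpen U ∧ M ⊆ U ∧
    ∃ δ : EuclideanSpace ℝ (Fin n) → ℝ, ContinuousOn δ M ∧ (∀ x ∈ M, 0 < δ x) ∧
      IsDiffeoOnto
        (fun p : EuclideanSpace ℝ (Fin n) × EuclideanSpace ℝ (Fin n) => p.1 + p.2)
        {p | p ∈ normalBundle M ∧ ‖p.2‖ < δ p.1} U

/-- `x` is a point of `M` at minimum distance from `b`. -/
def IsNearestPoint (M : Set (EuclideanSpace ℝ (Fin n))) (b x : EuclideanSpace ℝ (Fin n)) : Prop :=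
  x ∈ M ∧ ∀ y ∈ M, dist b x ≤ dist b y

end Submanifold

section Systems

/-- The real zero set in `ℝⁿ` of a polynomial system. -/
def realZeroSet {n k : ℕ} (h : Fin k → MvPolynomial (Fin n) ℝ) :
    Set (EuclideanSpace ℝ (Fin n)) :=
  {x | ∀ j, MvPolynomial.eval (fun i => x i) (h j) = 0}

/-- The Jacobian matrix of a real polynomial system, evaluated at a point with coordinates in a
commutative `ℝ`-algebra. -/
noncomputable def jacobian {σ τ A : Type*} [CommRing A] [Algebra ℝ A]
    (F : τ → MvPolynomial σ ℝ) (z : σ → A) : Matrix τ σ A :=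
  Matrix.of fun j i => MvPolynomial.aeval z (MvPolynomial.pderiv i (F j))

/-- The Lagrange system of `min ‖x - b‖² / 2` subject to `h x = 0`, as a square polynomial system
in the variables `x` (left) and the multipliers `lam` (right):
`x i - b i - ∑ j, lam j * ∂h j / ∂x i = 0` for all `i`, and `h j x = 0` for all `j`. -/
noncomputable def lagrangeSystem {n k : ℕ} (h : Fin k → MvPolynomial (Fin n) ℝ)
    (b : EuclideanSpace ℝ (Fin n)) :
    Fin n ⊕ Fin k → MvPolynomial (Fin n ⊕ Fin k) ℝ :=
  Sum.elim
    (fun i => MvPolynomial.X (Sum.inl i) - MvPolynomial.C (b i) -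
      ∑ j, MvPolynomial.X (Sum.inr j) *
        MvPolynomial.rename Sum.inl (MvPolynomial.pderiv i (h j)))
    (fun j => MvPolynomial.rename Sum.inl (h j))

/-- `z` is a complex zero of the real polynomial system `F`. -/
def IsComplexZero {σ τ : Type*} (F : τ → MvPolynomial σ ℝ) (z : σ → ℂ) : Prop :=
  ∀ j, MvPolynomial.aeval z (F j) = 0

/-- `z` is an isolated point of the complex zero set of `F`. -/
def IsIsolatedZero {σ τ : Type*} (F : τ → MvPolynomial σ ℝ) (z : σ → ℂ) : Prop :=
  IsComplexZero F z ∧ ∃ O : Set (σ → ℂ), IsOpen O ∧ z ∈ O ∧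
    ∀ z' ∈ O, IsComplexZero F z' → z' = z

/-- `z` is a simple zero of the square system `F`: a zero with nonsingular Jacobian matrix. -/
def IsSimpleZero {σ : Type*} [Fintype σ] [DecidableEq σ] (F : σ → MvPolynomial σ ℝ)
    (z : σ → ℂ) : Prop :=
  IsComplexZero F z ∧ (jacobian F z).det ≠ 0

/-- The point `(x, lam)` with real coordinates, regarded as a complex point. -/
def complexPoint {n k : ℕ} (x : EuclideanSpace ℝ (Fin n)) (lam : Fin k → ℝ) :
    Fin n ⊕ Fin k → ℂ :=
  Sum.elim (fun i => (x i : ℂ)) (fun j => (lam j : ℂ))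

end Systems

end TubularLagrange

open TubularLagrange

/-!
Write `H` for the constraint map, `A = H'(x)`, and let `T` be a right inverse of `A`. The map
`y ↦ y + T (H y - A y)` is a chart at `x` in which `V = H⁻¹(0)` becomes linear; hence `V` is a
submanifold with tangent space `ker A` and normal space `(ker A)ᗮ = range A†`.

The Lagrange map `L (x, μ) = (x - H'(x)† μ, H x)` takes the value `(b, 0)` exactly at the feet `x`
of normals from `b` to `V` with their multipliers. It is a local diffeomorphism at `(x, 0)`, because
`A A†` is invertible. A nearest point to a `b` close to `x` is the foot of a short normal close to
`x`, hence has a small multiplier and lies where `L` is injective: it is unique and nondegenerate,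
and the local inverse of `L` makes it depend smoothly on `b`. Uniqueness of nearest points also
makes `(x, v) ↦ x + v` injective on normals below a suitable continuous length.

The multiplier at a given foot is determined, also over `ℂ`, because the real Jacobian has full
rank; a nonsingular zero is isolated by the inverse function theorem over `ℂ`.
-/

namespace TubularLagrange

section InverseFunction

theorem isInvertible_of_bijective {𝕜 X Y : Type*} [NontriviallyNormedField 𝕜]
    [NormedAddCommGroup X] [NormedSpace 𝕜 X] [CompleteSpace X]
    [NormedAddCommGroup Y] [NormedSpace 𝕜 Y] [CompleteSpace Y] {A : X →L[𝕜] Y}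
    (hA : Function.Bijective A) : A.IsInvertible :=
  ⟨.ofBijective A (LinearMap.ker_eq_bot.2 hA.1) (LinearMap.range_eq_top.2 hA.2),
    ContinuousLinearEquiv.coe_ofBijective _ _ _⟩

variable {𝕜 X Y : Type*} [RCLike 𝕜] [NormedAddCommGroup X] [NormedSpace 𝕜 X]
  [NormedAddCommGroup Y] [NormedSpace 𝕜 Y]

theorem exists_openPartialHomeomorph_of_isInvertible_fderiv [CompleteSpace X] {f : X → Y}
    {m : WithTop ℕ∞} (hf : ContDiff 𝕜 m f) (hm : m ≠ 0) {x : X}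
    (hx : (fderiv 𝕜 f x).IsInvertible) :
    ∃ φ : OpenPartialHomeomorph X Y, ⇑φ = f ∧ x ∈ φ.source ∧
      (∀ y ∈ φ.source, (fderiv 𝕜 f y).IsInvertible) ∧ ContDiffOn 𝕜 m φ.symm φ.target := by
  have hderiv (y : X) : HasFDerivAt f (fderiv 𝕜 f y) y := (hf.differentiable hm y).hasFDerivAt
  obtain ⟨e, he⟩ := hx
  have hex : HasFDerivAt f (e : X →L[𝕜] Y) x := he ▸ hderiv x
  let φ₀ := hf.contDiffAt.toOpenPartialHomeomorph f hex hm
  let O : Set X := {y | (fderiv 𝕜 f y).IsInvertible}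
  have hO : IsOpen O := ContinuousLinearEquiv.isOpen.preimage (hf.continuous_fderiv hm)
  refine ⟨φ₀.restrOpen O hO, rfl,
    ⟨hf.contDiffAt.mem_toOpenPartialHomeomorph_source hex hm, e, he⟩, fun y hy => hy.2,
    fun b hb => ContDiffAt.contDiffWithinAt ?_⟩
  obtain ⟨e', he'⟩ := ((φ₀.restrOpen O hO).map_target hb).2
  exact OpenPartialHomeomorph.contDiffAt_symm _ hb (he' ▸ hderiv _) hf.contDiffAt

/-- Correct the identity along a right inverse `T` of `A = H'(x)`: the map
`y ↦ y + T (H y - A y)` has derivative `1` at `x`, and `A` carries its value at `y` to `H y`. -/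
theorem exists_straightening_chart [CompleteSpace X] {H : X → Y} {m : WithTop ℕ∞}
    (hH : ContDiff 𝕜 m H) (hm : m ≠ 0) {x : X} (hx : (fderiv 𝕜 H x).HasRightInverse) :
    ∃ φ : OpenPartialHomeomorph X X, x ∈ φ.source ∧ ContDiff 𝕜 m φ ∧
      ContDiffOn 𝕜 m φ.symm φ.target ∧ HasFDerivAt φ (.id 𝕜 X) x ∧
      ∀ y, fderiv 𝕜 H x (φ y) = H y := by
  obtain ⟨T, hT⟩ := hx
  set A := fderiv 𝕜 H x
  let f : X → X := fun y => y + T (H y - A y)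
  have hf : ContDiff 𝕜 m f := contDiff_id.add (T.contDiff.comp (hH.sub A.contDiff))
  have hfx : HasFDerivAt f (.id 𝕜 X) x := by
    have hHx : HasFDerivAt H A x := (hH.differentiable hm x).hasFDerivAt
    exact ((hasFDerivAt_id x).add (T.hasFDerivAt.comp x (hHx.sub A.hasFDerivAt))).congr_fderiv
      (by simp)
  obtain ⟨φ, hφ, hxφ, -, hsymm⟩ := exists_openPartialHomeomorph_of_isInvertible_fderiv hf hm
    (x := x) (by rw [hfx.fderiv]; exact ContinuousLinearMap.isInvertible_equiv (f := .refl 𝕜 X))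
  refine ⟨φ, hxφ, hφ ▸ hf, hsymm, hφ ▸ hfx, fun y => ?_⟩
  simp only [hφ, f, map_add, hT (H y - A y), add_sub_cancel]

end InverseFunction

section Adjoint

open ContinuousLinearMap

variable {𝕜 E F : Type*} [RCLike 𝕜] [NormedAddCommGroup E] [InnerProductSpace 𝕜 E]
  [CompleteSpace E] [NormedAddCommGroup F] [InnerProductSpace 𝕜 F] [CompleteSpace F]

theorem hasLeftInverse_adjoint {A : E →L[𝕜] F} (hA : A.HasRightInverse) :
    (adjoint A).HasLeftInverse := by
  obtain ⟨T, hT⟩ := hA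
  have hAT : A ∘L T = .id 𝕜 F := ContinuousLinearMap.ext hT
  refine ⟨adjoint T, fun c => ?_⟩
  rw [← comp_apply, ← adjoint_comp, hAT, adjoint_id, id_apply]

theorem range_adjoint_eq_orthogonal_ker {A : E →L[𝕜] F} (hA : A.HasRightInverse) :
    (adjoint A).range = A.kerᗮ := by
  rw [orthogonal_ker, (hasLeftInverse_adjoint hA).isClosed_range.submodule_topologicalClosure_eq]

theorem isInvertible_comp_adjoint {A : E →L[𝕜] F} (hA : A.HasRightInverse) :
    (A ∘L adjoint A).IsInvertible := by
  refine isInvertible_of_bijective ⟨?_, fun c => ?_⟩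
  · exact (self_comp_adjoint_injective_iff A).2 (hasLeftInverse_adjoint hA).injective
  · obtain ⟨u, rfl⟩ := hA.surjective c
    obtain ⟨w, hw, v, hv, rfl⟩ := A.ker.exists_add_mem_mem_orthogonal u
    rw [← range_adjoint_eq_orthogonal_ker hA] at hv
    obtain ⟨μ, rfl⟩ := hv
    exact ⟨μ, by simp_all⟩

end Adjoint

section LagrangeMap

open ContinuousLinearMap

variable {E F : Type*} [NormedAddCommGroup E] [InnerProductSpace ℝ E] [CompleteSpace E]
  [NormedAddCommGroup F] [InnerProductSpace ℝ F] [CompleteSpace F]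

theorem contDiff_adjoint {m : WithTop ℕ∞} :
    ContDiff ℝ m (fun A : E →L[ℝ] F => adjoint A) :=
  IsBoundedLinearMap.contDiff
    { map_add := map_add _
      map_smul := fun c A => by simp
      bound := ⟨1, one_pos, fun A => by simp⟩ }

/-- The Lagrange map `(x, μ) ↦ (x - H'(x)† μ, H x)` of a constraint `H x = 0`: its value is
`(b, 0)` exactly when `(x, μ)` solves the Lagrange system of `min ‖x - b‖² / 2` subject to
`H x = 0`. -/
noncomputable def lagrangeMap (H : E → F) (z : E × F) : E × F :=
  (z.1 - adjoint (fderiv ℝ H z.1) z.2, H z.1)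

/-- The multiplier `-(A A†)⁻¹ A v` which, for surjective `A` and `v ⟂ ker A`, solves
`A† μ = -v`. -/
noncomputable def multiplier (A : E →L[ℝ] F) (v : E) : F :=
  -(A ∘L adjoint A).inverse (A v)

theorem adjoint_multiplier {A : E →L[ℝ] F} (hA : A.HasRightInverse) {v : E} (hv : v ∈ A.kerᗮ) :
    adjoint A (multiplier A v) = -v := by
  rw [← range_adjoint_eq_orthogonal_ker hA] at hv
  obtain ⟨μ, rfl⟩ := hv
  have hμ : (A ∘L adjoint A).inverse (A (adjoint A μ)) = μ :=
    (isInvertible_comp_adjoint hA).inverse_apply_eq.2 rfl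
  simp only [multiplier, coe_coe, hμ, map_neg]

variable {H : E → F}

theorem lagrangeMap_eq_iff {x b : E} {μ : F} :
    lagrangeMap H (x, μ) = (b, 0) ↔ adjoint (fderiv ℝ H x) μ = x - b ∧ H x = 0 := by
  rw [lagrangeMap, Prod.mk.injEq, sub_eq_iff_eq_add, eq_sub_iff_add_eq', eq_comm]

theorem lagrangeMap_multiplier {x v : E} (hx : (fderiv ℝ H x).HasRightInverse) (hHx : H x = 0)
    (hv : v ∈ (fderiv ℝ H x).kerᗮ) :
    lagrangeMap H (x, multiplier (fderiv ℝ H x) v) = (x + v, 0) :=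
  lagrangeMap_eq_iff.2 ⟨by rw [adjoint_multiplier hx hv, sub_add_cancel_left], hHx⟩

theorem exists_lagrangeMap_eq_iff {x v : E} (hx : (fderiv ℝ H x).HasRightInverse) :
    (∃ μ, lagrangeMap H (x, μ) = (x + v, 0)) ↔ H x = 0 ∧ v ∈ (fderiv ℝ H x).kerᗮ := by
  refine ⟨fun ⟨μ, hμ⟩ => ?_, fun ⟨hHx, hv⟩ => ⟨_, lagrangeMap_multiplier hx hHx hv⟩⟩
  rw [lagrangeMap_eq_iff, sub_add_cancel_left] at hμ
  rw [← range_adjoint_eq_orthogonal_ker hx]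
  exact ⟨hμ.2, -μ, by simp [hμ.1]⟩

theorem contDiff_adjoint_fderiv (hH : ContDiff ℝ ∞ H) :
    ContDiff ℝ ∞ (fun x => adjoint (fderiv ℝ H x)) :=
  contDiff_adjoint.comp (hH.fderiv_right le_rfl)

theorem contDiff_lagrangeMap (hH : ContDiff ℝ ∞ H) : ContDiff ℝ ∞ (lagrangeMap H) :=
  (contDiff_fst.sub (((contDiff_adjoint_fderiv hH).comp contDiff_fst).clm_apply
    contDiff_snd)).prodMk (hH.comp contDiff_fst)

theorem continuousAt_multiplier {x₀ : E} (hH : ContDiff ℝ ∞ H)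
    (hx₀ : (fderiv ℝ H x₀).HasRightInverse) (v : E) :
    ContinuousAt (fun p : E × E => multiplier (fderiv ℝ H p.1) p.2) (x₀, v) := by
  have hA : Continuous fun p : E × E => fderiv ℝ H p.1 :=
    (hH.continuous_fderiv (by simp)).comp continuous_fst
  have hAA : Continuous fun p : E × E => fderiv ℝ H p.1 ∘L adjoint (fderiv ℝ H p.1) :=
    hA.clm_comp (adjoint.continuous.comp hA)
  have hinv : ContinuousAt ContinuousLinearMap.inverse
      (fderiv ℝ H x₀ ∘L adjoint (fderiv ℝ H x₀)) :=
    ((isInvertible_comp_adjoint hx₀).contDiffAt_map_inverse (n := 0)).continuousAt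
  exact ((hinv.comp_of_eq hAA.continuousAt rfl).clm_apply
    (hA.clm_apply continuous_snd).continuousAt).neg

theorem hasFDerivAt_lagrangeMap_zero (hH : ContDiff ℝ ∞ H) (x : E) :
    HasFDerivAt (lagrangeMap H) ((fst ℝ E F - adjoint (fderiv ℝ H x) ∘L snd ℝ E F).prod
      (fderiv ℝ H x ∘L fst ℝ E F)) (x, 0) := by
  have hadj : DifferentiableAt ℝ (fun z : E × F => adjoint (fderiv ℝ H z.1)) (x, 0) :=
    ((contDiff_adjoint_fderiv hH).comp contDiff_fst).differentiable (by simp) (x, 0)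
  have hHx : HasFDerivAt (fun z : E × F => H z.1) (fderiv ℝ H x ∘L fst ℝ E F) (x, 0) :=
    HasFDerivAt.comp (g := H) (x, 0) (hH.differentiable (by simp) x).hasFDerivAt hasFDerivAt_fst
  refine ((hasFDerivAt_fst.sub (hadj.hasFDerivAt.clm_apply hasFDerivAt_snd)).prodMk
    hHx).congr_fderiv ?_
  ext <;> simp

theorem isInvertible_fderiv_lagrangeMap_zero {x : E} (hH : ContDiff ℝ ∞ H)
    (hx : (fderiv ℝ H x).HasRightInverse) : (fderiv ℝ (lagrangeMap H) (x, 0)).IsInvertible := by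
  rw [(hasFDerivAt_lagrangeMap_zero hH x).fderiv]
  set A := fderiv ℝ H x
  have hG : (A ∘L adjoint A).IsInvertible := isInvertible_comp_adjoint hx
  refine isInvertible_of_bijective ⟨(injective_iff_map_eq_zero _).2 ?_, ?_⟩
  · rintro ⟨u, μ⟩ hz
    obtain ⟨rfl, hAu⟩ : u = adjoint A μ ∧ A u = 0 := by simpa [sub_eq_zero] using hz
    obtain rfl : μ = 0 := hG.injective (by simpa using hAu)
    simp
  · rintro ⟨w, c⟩
    obtain ⟨μ, hμ⟩ := hG.surjective (c - A w)
    have hμ : A (adjoint A μ) = c - A w := hμ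
    exact ⟨(w + adjoint A μ, μ), by simp [hμ]⟩

end LagrangeMap

section ZeroSet

variable {n : ℕ} {F : Type*} [NormedAddCommGroup F]

section Submersion

variable [NormedSpace ℝ F] {H : EuclideanSpace ℝ (Fin n) → F}

theorem isEmbeddedSubmanifold_preimage_zero (hH : ContDiff ℝ ∞ H)
    (hsub : ∀ x, H x = 0 → (fderiv ℝ H x).HasRightInverse) :
    IsEmbeddedSubmanifold (n - Module.finrank ℝ F) (H ⁻¹' {0}) := by
  intro x hx
  obtain ⟨φ, hxφ, hφ, hφsymm, -, hφH⟩ := exists_straightening_chart hH (by simp) (hsub x hx)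
  refine ⟨φ, hxφ, hφ.contDiffOn, hφsymm, (fderiv ℝ H x).ker, ?_, fun y _ => ?_⟩
  · have hrank := (fderiv ℝ H x).toLinearMap.finrank_range_add_finrank_ker
    rw [LinearMap.range_eq_top.2 (hsub x hx).surjective, finrank_top,
      finrank_euclideanSpace_fin] at hrank
    exact Nat.eq_sub_of_add_eq' hrank
  · rw [LinearMap.mem_ker, ContinuousLinearMap.coe_coe, hφH, Set.mem_preimage,
      Set.mem_singleton_iff]

variable {x w : EuclideanSpace ℝ (Fin n)}

theorem fderiv_apply_eq_zero_of_mem_tangentVectors (hH : DifferentiableAt ℝ H x)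
    (hw : w ∈ tangentVectors (H ⁻¹' {0}) x) : fderiv ℝ H x w = 0 := by
  obtain ⟨ε, γ, hε, -, hγM, rfl, hγ⟩ := hw
  have hzero : H ∘ γ =ᶠ[nhds 0] fun _ => 0 :=
    Filter.eventually_of_mem (Ioo_mem_nhds (neg_lt_zero.2 hε) hε) hγM
  exact (hH.hasFDerivAt.comp_hasDerivAt 0 hγ).unique
    ((hasDerivAt_const 0 0).congr_of_eventuallyEq hzero)

/-- In the straightening chart the zero set is linear, so a straight line there is a curve. -/
theorem mem_tangentVectors_of_fderiv_apply_eq_zero (hH : ContDiff ℝ ∞ H)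
    (hsub : (fderiv ℝ H x).HasRightInverse) (hx : H x = 0) (hw : fderiv ℝ H x w = 0) :
    w ∈ tangentVectors (H ⁻¹' {0}) x := by
  obtain ⟨φ, hxφ, -, hφsymm, hφx, hφH⟩ := exists_straightening_chart hH (by simp) hsub
  let line : ℝ → EuclideanSpace ℝ (Fin n) := fun t => φ x + t • w
  have hline : ContDiff ℝ ∞ line := contDiff_const.add (contDiff_id.smul contDiff_const)
  have hline0 : line 0 = φ x := by simp [line]
  have hderiv : HasDerivAt line w 0 :=
    (((hasDerivAt_id (0 : ℝ)).smul_const w).const_add (φ x)).congr_deriv (one_smul ℝ w)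
  obtain ⟨ε, hε, hball⟩ := Metric.isOpen_iff.1 (φ.open_target.preimage hline.continuous) 0
    (by simpa only [Set.mem_preimage, hline0] using φ.map_source hxφ)
  rw [Real.ball_eq_Ioo, zero_sub, zero_add] at hball
  refine ⟨ε, φ.symm ∘ line, hε, hφsymm.comp hline.contDiffOn hball, fun t ht => ?_, ?_, ?_⟩
  · calc H (φ.symm (line t)) = fderiv ℝ H x (φ x) + t • fderiv ℝ H x w := by
          rw [← hφH, φ.right_inv (hball ht), map_add, map_smul]
      _ = 0 := by rw [hφH, hx, hw, smul_zero, add_zero]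
  · rw [Function.comp_apply, hline0, φ.left_inv hxφ]
  · have hsymm : HasFDerivAt φ.symm (.id ℝ _) (line 0) :=
      φ.hasFDerivAt_symm (f' := .refl ℝ _) (hline0 ▸ φ.map_source hxφ)
        (by rwa [hline0, φ.left_inv hxφ])
    exact hsymm.comp_hasDerivAt 0 hderiv

theorem tangentVectors_preimage_zero (hH : ContDiff ℝ ∞ H)
    (hsub : (fderiv ℝ H x).HasRightInverse) (hx : H x = 0) :
    tangentVectors (H ⁻¹' {0}) x = (fderiv ℝ H x).ker :=
  Set.Subset.antisymm
    (fun _ => fderiv_apply_eq_zero_of_mem_tangentVectors (hH.differentiable (by simp) x))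
    (fun _ => mem_tangentVectors_of_fderiv_apply_eq_zero hH hsub hx)

theorem mem_normalBundle_preimage_zero {v : EuclideanSpace ℝ (Fin n)} (hH : ContDiff ℝ ∞ H)
    (hsub : (fderiv ℝ H x).HasRightInverse) :
    (x, v) ∈ normalBundle (H ⁻¹' {0}) ↔ H x = 0 ∧ v ∈ (fderiv ℝ H x).kerᗮ := by
  refine and_congr_right fun hx => ?_
  rw [tangentVectors_preimage_zero hH hsub hx, Submodule.mem_orthogonal']
  rfl

end Submersion

section NearestPoint

variable {M : Set (EuclideanSpace ℝ (Fin n))}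

theorem exists_isNearestPoint (hM : IsClosed M) (hne : M.Nonempty)
    (b : EuclideanSpace ℝ (Fin n)) : ∃ x, IsNearestPoint M b x := by
  obtain ⟨x, hx, hdist⟩ := hM.exists_infDist_eq_dist hne b
  exact ⟨x, hx, fun y hy => hdist ▸ Metric.infDist_le_dist_of_mem hy⟩

theorem IsNearestPoint.mem_normalBundle {b x : EuclideanSpace ℝ (Fin n)}
    (hx : IsNearestPoint M b x) : (x, b - x) ∈ normalBundle M := by
  refine ⟨hx.1, ?_⟩
  rintro w ⟨ε, γ, hε, -, hγM, rfl, hγ⟩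
  have hderiv : HasDerivAt (fun t => ‖b - γ t‖ ^ 2) (2 * inner ℝ (b - γ 0) (-w)) 0 := by
    simpa using (hγ.const_sub b).norm_sq
  have hmin : IsLocalMin (fun t => ‖b - γ t‖ ^ 2) 0 := by
    filter_upwards [Ioo_mem_nhds (neg_lt_zero.2 hε) hε] with t ht
    have hdist := hx.2 (γ t) (hγM t ht)
    rw [dist_eq_norm, dist_eq_norm] at hdist
    gcongr
  simpa using hmin.hasDerivAt_eq_zero hderiv

theorem eventually_isNearestPoint_mem {x₀ : EuclideanSpace ℝ (Fin n)} (hx₀ : x₀ ∈ M)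
    {S : Set (EuclideanSpace ℝ (Fin n) × EuclideanSpace ℝ (Fin n))} (hS : S ∈ nhds (x₀, 0)) :
    ∀ᶠ b in nhds x₀, ∀ y, IsNearestPoint M b y → (y, b - y) ∈ S := by
  obtain ⟨ε, hε, hball⟩ := Metric.mem_nhds_iff.1 hS
  filter_upwards [Metric.ball_mem_nhds x₀ (half_pos hε)] with b hb y hy
  have hby : dist b y ≤ dist b x₀ := hy.2 x₀ hx₀
  have hyx : dist y x₀ ≤ dist b y + dist b x₀ := dist_triangle_left y x₀ b
  rw [Metric.mem_ball] at hb
  refine hball (Metric.mem_ball.2 (max_lt ?_ ?_))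
  · linarith
  · rw [dist_zero_right, ← dist_eq_norm]
    linarith

end NearestPoint

section Tube

variable {M : Set (EuclideanSpace ℝ (Fin n))} {δ : EuclideanSpace ℝ (Fin n) → ℝ}

/-- The normal vectors `(x, v)` of `M` of length `‖v‖ < δ x`, the domain of a tube around `M`. -/
def normalTube (M : Set (EuclideanSpace ℝ (Fin n))) (δ : EuclideanSpace ℝ (Fin n) → ℝ) :
    Set (EuclideanSpace ℝ (Fin n) × EuclideanSpace ℝ (Fin n)) :=
  {p | p ∈ normalBundle M ∧ ‖p.2‖ < δ p.1}

/-- Through each point `c` near `b` passes a normal to `M` whose foot `π c` depends smoothly on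
`c`, and the foot at `b` is `x`. -/
def HasLocalFootPoint (M : Set (EuclideanSpace ℝ (Fin n))) (b x : EuclideanSpace ℝ (Fin n)) :
    Prop :=
  ∃ O, IsOpen O ∧ b ∈ O ∧ ∃ π : EuclideanSpace ℝ (Fin n) → EuclideanSpace ℝ (Fin n),
    ContDiffOn ℝ ∞ π O ∧ π b = x ∧ ∀ c ∈ O, (π c, c - π c) ∈ normalBundle M

theorem HasLocalFootPoint.exists_section {p : EuclideanSpace ℝ (Fin n) × EuclideanSpace ℝ (Fin n)}
    (hπ : HasLocalFootPoint M (p.1 + p.2) p.1) (hδ : ContinuousOn δ M)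
    (hp : p ∈ normalTube M δ) :
    ∃ O, IsOpen O ∧ p.1 + p.2 ∈ O ∧
      ∃ g : EuclideanSpace ℝ (Fin n) → EuclideanSpace ℝ (Fin n) × EuclideanSpace ℝ (Fin n),
        ContDiffOn ℝ ∞ g O ∧ ∀ b ∈ O, g b ∈ normalTube M δ ∧ (g b).1 + (g b).2 = b := by
  obtain ⟨O, hO, hpO, π, hπ, hπp, hnormal⟩ := hπ
  have hcont : ContinuousOn (fun b => δ (π b) - ‖b - π b‖) O :=
    (hδ.comp hπ.continuousOn fun b hb => (hnormal b hb).1).sub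
      (continuousOn_id.sub hπ.continuousOn).norm
  refine ⟨O ∩ (fun b => δ (π b) - ‖b - π b‖) ⁻¹' Set.Ioi 0,
    hcont.isOpen_inter_preimage hO isOpen_Ioi, ⟨hpO, ?_⟩, fun b => (π b, b - π b), ?_, ?_⟩
  · simpa [hπp] using hp.2
  · exact (hπ.prodMk (contDiffOn_id.sub hπ)).mono Set.inter_subset_left
  · exact fun b hb => ⟨⟨hnormal b hb.1, sub_pos.1 hb.2⟩, add_sub_cancel _ _⟩

theorem isTubularNeighborhood_image_normalTube (hδ : ContinuousOn δ M) (hpos : ∀ x ∈ M, 0 < δ x)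
    (hinj : (normalTube M δ).InjOn fun p => p.1 + p.2)
    (hfoot : ∀ p ∈ normalTube M δ, HasLocalFootPoint M (p.1 + p.2) p.1) :
    IsTubularNeighborhood M ((fun p => p.1 + p.2) '' normalTube M δ) := by
  refine ⟨?_, ?_, δ, hδ, hpos, hinj.bijOn_image, ?_, ?_⟩
  · rw [isOpen_iff_mem_nhds]
    rintro _ ⟨p, hp, rfl⟩
    obtain ⟨O, hO, hpO, g, -, hg⟩ := (hfoot p hp).exists_section hδ hp
    exact Filter.mem_of_superset (hO.mem_nhds hpO) fun b hb => ⟨g b, hg b hb⟩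
  · exact fun x hx => ⟨(x, 0), ⟨⟨hx, fun w _ => inner_zero_left _⟩, by simpa using hpos x hx⟩,
      add_zero x⟩
  · exact fun p _ => ⟨Set.univ, isOpen_univ, Set.mem_univ _, _,
      (contDiff_fst.add contDiff_snd).contDiffOn, fun _ _ => rfl⟩
  · have hinv := hinj.bijOn_image.invOn_invFunOn
    refine ⟨_, hinv, ?_⟩
    rintro _ ⟨p, hp, rfl⟩
    obtain ⟨O, hO, hpO, g, hg_smooth, hg⟩ := (hfoot p hp).exists_section hδ hp
    refine ⟨O, hO, hpO, g, hg_smooth, fun b hb => ?_⟩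
    obtain ⟨hgb, hadd⟩ := hg b hb.2
    simpa only [hadd] using hinv.1 hgb

theorem injOn_add_normalTube (hM : IsClosed M)
    (hfoot : ∀ p ∈ normalTube M δ, ∀ y, IsNearestPoint M (p.1 + p.2) y → y = p.1) :
    (normalTube M δ).InjOn fun p => p.1 + p.2 := by
  intro p hp q hq hpq
  change p.1 + p.2 = q.1 + q.2 at hpq
  obtain ⟨y, hy⟩ := exists_isNearestPoint hM ⟨p.1, hp.1.1⟩ (p.1 + p.2)
  have hfst : p.1 = q.1 := (hfoot p hp y hy).symm.trans (hfoot q hq y (hpq ▸ hy))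
  exact Prod.ext hfst (by rwa [hfst, add_right_inj] at hpq)

/-- The distance to the set of bad points is a radius that is both safe and continuous. -/
theorem exists_continuous_pos_radius {X V : Type*} [PseudoMetricSpace X]
    [SeminormedAddCommGroup V] {M : Set X} {P : X × V → Prop}
    (hP : ∀ x ∈ M, ∀ᶠ p in nhds (x, 0), P p) :
    ∃ δ : X → ℝ, Continuous δ ∧ (∀ x ∈ M, 0 < δ x) ∧ ∀ x v, ‖v‖ < δ x → P (x, v) := by
  rcases Set.eq_empty_or_nonempty {p | ¬P p} with hbad | hbad
  · exact ⟨1, continuous_one, fun _ _ => one_pos,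
      fun x v _ => not_not.1 (Set.eq_empty_iff_forall_notMem.1 hbad (x, v))⟩
  refine ⟨fun x => Metric.infDist (x, 0) {p | ¬P p},
    (Metric.continuous_infDist_pt _).comp (continuous_id.prodMk continuous_const),
    fun x hx => ?_, fun x v hv => ?_⟩
  · change 0 < Metric.infDist (x, 0) {p | ¬P p}
    rw [← Metric.infDist_closure, ← isClosed_closure.notMem_iff_infDist_pos hbad.closure,
      mem_closure_iff_frequently, Filter.not_frequently]
    exact (hP x hx).mono fun _ => not_not.2
  · by_contra hxv
    refine hv.not_ge ((Metric.infDist_le_dist_of_mem hxv).trans_eq ?_)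
    simp [Prod.dist_eq]

end Tube

section RegularNormal

variable [InnerProductSpace ℝ F] [CompleteSpace F] {H : EuclideanSpace ℝ (Fin n) → F}

/-- The vector `p = (x, v)` is a regular normal of `H ⁻¹' {0}`: no point other than `x` can be
nearest to `x + v`, and `x` solves the Lagrange system for `x + v` nondegenerately. -/
def IsRegularNormal (H : EuclideanSpace ℝ (Fin n) → F)
    (p : EuclideanSpace ℝ (Fin n) × EuclideanSpace ℝ (Fin n)) : Prop :=
  (∀ y, IsNearestPoint (H ⁻¹' {0}) (p.1 + p.2) y → y = p.1) ∧
    ∃ μ, lagrangeMap H (p.1, μ) = (p.1 + p.2, 0) ∧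
      (fderiv ℝ (lagrangeMap H) (p.1, μ)).IsInvertible

/-- Nearest points to a point close to `x₀` are, with their multipliers, preimages of that point
under the Lagrange map close to `(x₀, 0)`, where the map is injective. -/
theorem eventually_isRegularNormal (hH : ContDiff ℝ ∞ H)
    (hsub : ∀ x, H x = 0 → (fderiv ℝ H x).HasRightInverse) {x₀ : EuclideanSpace ℝ (Fin n)}
    (hx₀ : H x₀ = 0) :
    ∀ᶠ p in nhds (x₀, 0), p ∈ normalBundle (H ⁻¹' {0}) → IsRegularNormal H p := by
  obtain ⟨φ, hφ, hx₀φ, hφinv, -⟩ := exists_openPartialHomeomorph_of_isInvertible_fderiv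
    (contDiff_lagrangeMap hH) (by simp) (isInvertible_fderiv_lagrangeMap_zero hH (hsub x₀ hx₀))
  let lift (p : EuclideanSpace ℝ (Fin n) × EuclideanSpace ℝ (Fin n)) :
      EuclideanSpace ℝ (Fin n) × F := (p.1, multiplier (fderiv ℝ H p.1) p.2)
  have hlift {p} (hp : p ∈ normalBundle (H ⁻¹' {0})) : φ (lift p) = (p.1 + p.2, 0) := by
    have hsubp := hsub p.1 hp.1
    obtain ⟨hHp, hp⟩ := (mem_normalBundle_preimage_zero hH hsubp).1 hp
    rw [hφ, lagrangeMap_multiplier hsubp hHp hp]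
  have hlift0 : lift (x₀, 0) = (x₀, 0) := by simp [lift, multiplier]
  have hsource : ∀ᶠ p in nhds (x₀, 0), lift p ∈ φ.source :=
    (continuousAt_fst.prodMk (continuousAt_multiplier hH (hsub x₀ hx₀) 0)).eventually_mem
      (φ.open_source.mem_nhds (show lift (x₀, 0) ∈ φ.source by rwa [hlift0]))
  have hadd : Filter.Tendsto (fun p : EuclideanSpace ℝ (Fin n) × EuclideanSpace ℝ (Fin n) =>
      p.1 + p.2) (nhds (x₀, 0)) (nhds x₀) :=
    (continuous_add.tendsto _).trans_eq (by simp)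
  filter_upwards [hsource, hadd.eventually
    (eventually_isNearestPoint_mem (M := H ⁻¹' {0}) hx₀ hsource)] with p hp hnear hnormal
  refine ⟨fun y hy => ?_, _, hφ ▸ hlift hnormal, hφinv _ hp⟩
  have hy_lift := hlift hy.mem_normalBundle
  rw [add_sub_cancel, ← hlift hnormal] at hy_lift
  exact congrArg Prod.fst (φ.injOn (hnear y hy) hp hy_lift)

theorem IsRegularNormal.hasLocalFootPoint
    {p : EuclideanSpace ℝ (Fin n) × EuclideanSpace ℝ (Fin n)} (hp : IsRegularNormal H p)
    (hH : ContDiff ℝ ∞ H) (hsub : ∀ x, H x = 0 → (fderiv ℝ H x).HasRightInverse) :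
    HasLocalFootPoint (H ⁻¹' {0}) (p.1 + p.2) p.1 := by
  obtain ⟨-, μ, hμ, hinv⟩ := hp
  obtain ⟨φ, hφ, hμφ, -, hφsymm⟩ := exists_openPartialHomeomorph_of_isInvertible_fderiv
    (contDiff_lagrangeMap hH) (by simp) hinv
  rw [← hφ] at hμ
  let ι : EuclideanSpace ℝ (Fin n) → EuclideanSpace ℝ (Fin n) × F := fun b => (b, 0)
  have hι : ContDiff ℝ ∞ ι := contDiff_id.prodMk contDiff_const
  refine ⟨ι ⁻¹' φ.target, φ.open_target.preimage hι.continuous, ?_, fun b => (φ.symm (ι b)).1,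
    (hφsymm.comp hι.contDiffOn fun _ hb => hb).fst, ?_, fun b hb => ?_⟩
  · change (p.1 + p.2, 0) ∈ φ.target
    exact hμ ▸ φ.map_source hμφ
  · simp only [ι, ← hμ, φ.left_inv hμφ]
  · have hb : lagrangeMap H (φ.symm (ι b)) = (b, 0) := hφ ▸ φ.right_inv hb
    have hsubb := hsub _ (lagrangeMap_eq_iff.1 hb).2
    refine (mem_normalBundle_preimage_zero hH hsubb).2 ((exists_lagrangeMap_eq_iff hsubb).1 ?_)
    exact ⟨(φ.symm (ι b)).2, hb.trans (Prod.ext (add_sub_cancel _ _).symm rfl)⟩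

theorem exists_isTubularNeighborhood_preimage_zero (hH : ContDiff ℝ ∞ H)
    (hsub : ∀ x, H x = 0 → (fderiv ℝ H x).HasRightInverse) :
    ∃ U, IsTubularNeighborhood (H ⁻¹' {0}) U ∧ ∀ b ∈ U, ∃ x,
      IsNearestPoint (H ⁻¹' {0}) b x ∧ (∀ y, IsNearestPoint (H ⁻¹' {0}) b y → y = x) ∧
      ∃ μ, lagrangeMap H (x, μ) = (b, 0) ∧ (fderiv ℝ (lagrangeMap H) (x, μ)).IsInvertible := by
  have hM : IsClosed (H ⁻¹' {0}) := isClosed_singleton.preimage hH.continuous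
  obtain ⟨δ, hδ, hpos, hreg⟩ := exists_continuous_pos_radius (M := H ⁻¹' {0})
    fun x hx => eventually_isRegularNormal hH hsub hx
  have hreg (p) (hp : p ∈ normalTube (H ⁻¹' {0}) δ) : IsRegularNormal H p :=
    hreg p.1 p.2 hp.2 hp.1
  refine ⟨_, isTubularNeighborhood_image_normalTube hδ.continuousOn hpos
    (injOn_add_normalTube hM fun p hp => (hreg p hp).1)
    fun p hp => (hreg p hp).hasLocalFootPoint hH hsub, ?_⟩
  rintro _ ⟨p, hp, rfl⟩
  obtain ⟨hunique, hμ⟩ := hreg p hp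
  obtain ⟨y, hy⟩ := exists_isNearestPoint hM ⟨p.1, hp.1.1⟩ (p.1 + p.2)
  exact ⟨p.1, hunique y hy ▸ hy, hunique, hμ⟩

end RegularNormal

end ZeroSet

section PolynomialMap

variable {σ τ : Type*}

section Derivative

variable {𝕜 : Type*} [NontriviallyNormedField 𝕜]

theorem hasFDerivAt_aeval {R : Type*} [CommSemiring R] [Algebra R 𝕜] [Fintype σ]
    (p : MvPolynomial σ R) (z : σ → 𝕜) :
    HasFDerivAt (fun z : σ → 𝕜 => MvPolynomial.aeval z p)
      (∑ i, MvPolynomial.aeval z (MvPolynomial.pderiv i p) •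
        ContinuousLinearMap.proj (R := 𝕜) (φ := fun _ : σ => 𝕜) i) z := by
  classical
  induction p using MvPolynomial.induction_on with
  | C a =>
    simp only [MvPolynomial.aeval_C]
    exact (hasFDerivAt_const _ z).congr_fderiv (by ext v; simp)
  | add p q hp hq =>
    simp only [map_add]
    exact (hp.fun_add hq).congr_fderiv (by ext v; simp [add_mul, Finset.sum_add_distrib])
  | mul_X p i hp =>
    simp only [map_mul, MvPolynomial.aeval_X]
    refine (hp.fun_mul (hasFDerivAt_apply i z)).congr_fderiv ?_
    ext v
    simp [Derivation.leibniz, MvPolynomial.pderiv_X, Pi.single_apply, apply_ite, add_mul,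
      Finset.sum_add_distrib, Finset.mul_sum, mul_assoc]

/-- The map `A^σ → A^τ` given by the polynomial system `F`, for a commutative `ℝ`-algebra `A`. -/
noncomputable def polyMap {A : Type*} [CommRing A] [Algebra ℝ A] (F : τ → MvPolynomial σ ℝ)
    (z : σ → A) : τ → A :=
  fun j => MvPolynomial.aeval z (F j)

variable [CompleteSpace 𝕜] [Algebra ℝ 𝕜] [Fintype σ]

theorem hasFDerivAt_polyMap [Finite τ] (F : τ → MvPolynomial σ ℝ)
    (z : σ → 𝕜) :
    HasFDerivAt (polyMap F) (LinearMap.toContinuousLinearMap (jacobian F z).mulVecLin) z := by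
  have := Fintype.ofFinite τ
  refine hasFDerivAt_pi'.2 fun j => (hasFDerivAt_aeval (F j) z).congr_fderiv ?_
  ext v
  simp [jacobian, Matrix.mulVec, dotProduct]

theorem contDiff_polyMap [Fintype τ] (F : τ → MvPolynomial σ ℝ) {m : WithTop ℕ∞} :
    ContDiff 𝕜 m (polyMap F : (σ → 𝕜) → τ → 𝕜) :=
  contDiff_pi.2 fun j => contDiff_iff_contDiffAt.2 fun z =>
    (AnalyticAt.aeval_mvPolynomial (f := fun z : σ → 𝕜 => z)
      (fun i => (ContinuousLinearMap.proj (R := 𝕜) (φ := fun _ : σ => 𝕜) i).analyticAt z)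
      (F j)).contDiffAt

theorem isInvertible_fderiv_polyMap_iff [DecidableEq σ] {F : σ → MvPolynomial σ ℝ}
    {z : σ → 𝕜} :
    (fderiv 𝕜 (polyMap F) z).IsInvertible ↔ (jacobian F z).det ≠ 0 := by
  rw [(hasFDerivAt_polyMap F z).fderiv, ← isUnit_iff_ne_zero, ← Matrix.isUnit_iff_isUnit_det]
  exact ⟨fun h => Matrix.mulVec_injective_iff_isUnit.1 h.injective, fun h =>
    isInvertible_of_bijective
      ⟨Matrix.mulVec_injective_iff_isUnit.2 h, Matrix.mulVec_surjective_iff_isUnit.2 h⟩⟩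

end Derivative

theorem IsSimpleZero.isIsolatedZero [Fintype σ] [DecidableEq σ] {F : σ → MvPolynomial σ ℝ}
    {z : σ → ℂ} (hz : IsSimpleZero F z) : IsIsolatedZero F z := by
  obtain ⟨φ, hφ, hzφ, -, -⟩ := exists_openPartialHomeomorph_of_isInvertible_fderiv
    (contDiff_polyMap F (m := 1)) one_ne_zero (isInvertible_fderiv_polyMap_iff.2 hz.2)
  refine ⟨hz.1, φ.source, φ.open_source, hzφ, fun z' hz'φ hz' => φ.injOn hz'φ hzφ ?_⟩
  rw [hφ]
  exact funext fun j => (hz' j).trans (hz.1 j).symm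

theorem jacobian_algebraMap_comp (F : τ → MvPolynomial σ ℝ) (z : σ → ℝ) :
    jacobian F (algebraMap ℝ ℂ ∘ z) = (jacobian F z).map (algebraMap ℝ ℂ) :=
  Matrix.ext fun _ _ => MvPolynomial.aeval_algebraMap_apply ℂ z _

theorem isSimpleZero_algebraMap_comp [Fintype σ] [DecidableEq σ] {F : σ → MvPolynomial σ ℝ}
    {z : σ → ℝ} (hz : polyMap F z = 0) (hinv : (fderiv ℝ (polyMap F) z).IsInvertible) :
    IsSimpleZero F (algebraMap ℝ ℂ ∘ z) := by
  refine ⟨fun j => ?_, ?_⟩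
  · exact (MvPolynomial.aeval_algebraMap_apply ℂ z (F j)).trans
      (by rw [show MvPolynomial.aeval z (F j) = 0 from congrFun hz j, map_zero])
  · rw [jacobian_algebraMap_comp, ← RingHom.mapMatrix_apply, ← RingHom.map_det]
    exact (map_ne_zero _).2 (isInvertible_fderiv_polyMap_iff.1 hinv)

end PolynomialMap

section Constraints

variable {n k : ℕ}

/-- The polynomial map `h` between Euclidean spaces. -/
noncomputable def constraintMap (h : Fin k → MvPolynomial (Fin n) ℝ)
    (x : EuclideanSpace ℝ (Fin n)) : EuclideanSpace ℝ (Fin k) :=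
  WithLp.toLp 2 (polyMap h x.ofLp)

variable {h : Fin k → MvPolynomial (Fin n) ℝ}

theorem constraintMap_preimage_zero : constraintMap h ⁻¹' {0} = realZeroSet h := by
  ext x
  simp [constraintMap, realZeroSet, polyMap, funext_iff, MvPolynomial.aeval_eq_eval]

theorem contDiff_constraintMap {m : WithTop ℕ∞} : ContDiff ℝ m (constraintMap h) :=
  (EuclideanSpace.equiv (Fin k) ℝ).symm.contDiff.comp
    ((contDiff_polyMap h).comp (EuclideanSpace.equiv (Fin n) ℝ).contDiff)

theorem fderiv_constraintMap (x : EuclideanSpace ℝ (Fin n)) :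
    fderiv ℝ (constraintMap h) x =
      LinearMap.toContinuousLinearMap (jacobian h x.ofLp).toEuclideanLin :=
  HasFDerivAt.fderiv <| (EuclideanSpace.equiv (Fin k) ℝ).symm.hasFDerivAt.comp x <|
    HasFDerivAt.comp (g := polyMap h) x (hasFDerivAt_polyMap h x.ofLp)
      (EuclideanSpace.equiv (Fin n) ℝ).hasFDerivAt

theorem adjoint_fderiv_constraintMap (x : EuclideanSpace ℝ (Fin n)) :
    ContinuousLinearMap.adjoint (fderiv ℝ (constraintMap h) x) =
      LinearMap.toContinuousLinearMap (jacobian h x.ofLp).transpose.toEuclideanLin := by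
  rw [fderiv_constraintMap, ← Matrix.conjTranspose_eq_transpose_of_trivial,
    Matrix.toEuclideanLin_conjTranspose_eq_adjoint]
  rfl

theorem mulVec_surjective_of_rank_eq_card {K ι κ : Type*} [Field K] [Fintype ι] [Fintype κ]
    {A : Matrix ι κ K} (hA : A.rank = Fintype.card ι) : Function.Surjective A.mulVec :=
  (LinearMap.range_eq_top (f := A.mulVecLin)).1
    (Submodule.eq_top_of_finrank_eq (hA.trans (Module.finrank_fintype_fun_eq_card K).symm))

theorem hasRightInverse_fderiv_constraintMap {x : EuclideanSpace ℝ (Fin n)}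
    (hx : (jacobian h x.ofLp).rank = k) : (fderiv ℝ (constraintMap h) x).HasRightInverse := by
  rw [fderiv_constraintMap]
  refine .of_surjective_of_finiteDimensional fun c => ?_
  obtain ⟨v, hv⟩ := mulVec_surjective_of_rank_eq_card (hx.trans (Fintype.card_fin k).symm) c.ofLp
  exact ⟨WithLp.toLp 2 v, congrArg (WithLp.toLp 2) hv⟩

end Constraints

section LagrangeSystem

variable {n k : ℕ} {h : Fin k → MvPolynomial (Fin n) ℝ} {b x : EuclideanSpace ℝ (Fin n)}
  {μ : EuclideanSpace ℝ (Fin k)}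

/-- The coordinates of a point and a multiplier, in the variables of `lagrangeSystem`. -/
noncomputable def coords :
    (EuclideanSpace ℝ (Fin n) × EuclideanSpace ℝ (Fin k)) ≃L[ℝ] (Fin n ⊕ Fin k → ℝ) :=
  ((EuclideanSpace.equiv (Fin n) ℝ).prodCongr (EuclideanSpace.equiv (Fin k) ℝ)).trans
    (ContinuousLinearEquiv.sumPiEquivProdPi ℝ (Fin n) (Fin k) fun _ => ℝ).symm

theorem complexPoint_eq_algebraMap_comp_coords :
    complexPoint x μ = algebraMap ℝ ℂ ∘ coords (x, μ) := by
  ext (i | j) <;> rfl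

theorem polyMap_lagrangeSystem_coords (z : EuclideanSpace ℝ (Fin n) × EuclideanSpace ℝ (Fin k)) :
    polyMap (lagrangeSystem h b) (coords z) =
      coords (lagrangeMap (constraintMap h) z - (b, 0)) := by
  have hinl : coords z ∘ Sum.inl = z.1.ofLp := rfl
  ext (i | j)
  · have hX : coords z (Sum.inl i) = z.1 i := rfl
    have hΛ (j : Fin k) : coords z (Sum.inr j) = z.2 j := rfl
    have hright : coords (lagrangeMap (constraintMap h) z - (b, 0)) (Sum.inl i) =
      z.1 i - ContinuousLinearMap.adjoint (fderiv ℝ (constraintMap h) z.1) z.2 i - b i := rfl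
    rw [hright, adjoint_fderiv_constraintMap]
    simp [polyMap, lagrangeSystem, MvPolynomial.eval_rename, hinl, hX, hΛ, jacobian,
      Matrix.toLpLin_apply, Matrix.mulVec, dotProduct, mul_comm, sub_right_comm]
  · have hright : coords (lagrangeMap (constraintMap h) z - (b, 0)) (Sum.inr j) =
      polyMap h z.1.ofLp j - 0 := rfl
    rw [hright, sub_zero, polyMap, lagrangeSystem, Sum.elim_inr, MvPolynomial.aeval_rename, hinl]
    rfl

theorem isInvertible_fderiv_polyMap_lagrangeSystem
    {z : EuclideanSpace ℝ (Fin n) × EuclideanSpace ℝ (Fin k)} :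
    (fderiv ℝ (polyMap (lagrangeSystem h b)) (coords z)).IsInvertible ↔
      (fderiv ℝ (lagrangeMap (constraintMap h)) z).IsInvertible := by
  have hconj : polyMap (lagrangeSystem h b) ∘ coords =
      coords ∘ fun z => lagrangeMap (constraintMap h) z - (b, 0) :=
    funext polyMap_lagrangeSystem_coords
  rw [← ContinuousLinearMap.isInvertible_comp_equiv (e := coords),
    ← ContinuousLinearEquiv.comp_right_fderiv, hconj, ContinuousLinearEquiv.comp_fderiv,
    ContinuousLinearMap.isInvertible_equiv_comp, fderiv_sub_const]

theorem isSimpleZero_complexPoint (hzero : lagrangeMap (constraintMap h) (x, μ) = (b, 0))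
    (hinv : (fderiv ℝ (lagrangeMap (constraintMap h)) (x, μ)).IsInvertible) :
    IsSimpleZero (lagrangeSystem h b) (complexPoint x μ) := by
  rw [complexPoint_eq_algebraMap_comp_coords]
  refine isSimpleZero_algebraMap_comp ?_ (isInvertible_fderiv_polyMap_lagrangeSystem.2 hinv)
  rw [polyMap_lagrangeSystem_coords, hzero, sub_self, map_zero]

variable {z z' : Fin n ⊕ Fin k → ℂ}

theorem IsComplexZero.vecMul_jacobian (hz : IsComplexZero (lagrangeSystem h b) z) :
    Matrix.vecMul (z ∘ Sum.inr) (jacobian h (z ∘ Sum.inl)) = fun i => z (Sum.inl i) - b i := by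
  ext i
  have hi := hz (Sum.inl i)
  simp only [lagrangeSystem, Sum.elim_inl, map_sub, MvPolynomial.aeval_X, MvPolynomial.aeval_C,
    map_sum, map_mul, MvPolynomial.aeval_rename] at hi
  exact (sub_eq_zero.1 hi).symm

theorem IsComplexZero.eq_of_comp_inl_eq (hz : IsComplexZero (lagrangeSystem h b) z)
    (hz' : IsComplexZero (lagrangeSystem h b) z') (hzz' : z ∘ Sum.inl = z' ∘ Sum.inl)
    (hinj : Function.Injective (jacobian h (z ∘ Sum.inl)).vecMul) : z = z' := by
  have hinr : z ∘ Sum.inr = z' ∘ Sum.inr := hinj <| by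
    change Matrix.vecMul _ _ = Matrix.vecMul _ _
    rw [hz.vecMul_jacobian, hzz', hz'.vecMul_jacobian]
    exact funext fun i => congrArg (· - (b i : ℂ)) (congrFun hzz' i)
  rw [← Sum.elim_comp_inl_inr z, hzz', hinr, Sum.elim_comp_inl_inr]

theorem vecMul_injective_jacobian_algebraMap_comp {ξ : Fin n → ℝ}
    (hξ : (jacobian h ξ).rank = k) :
    Function.Injective fun c => Matrix.vecMul c (jacobian h (algebraMap ℝ ℂ ∘ ξ)) := by
  obtain ⟨B, hB⟩ := Matrix.mulVec_surjective_iff_exists_right_inverse.1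
    (mulVec_surjective_of_rank_eq_card (hξ.trans (Fintype.card_fin k).symm))
  rw [jacobian_algebraMap_comp]
  refine Function.LeftInverse.injective
    (g := fun c => Matrix.vecMul c (B.map (algebraMap ℝ ℂ))) fun c => ?_
  simp only [Matrix.vecMul_vecMul]
  rw [← Matrix.map_mul, hB, Matrix.map_one _ (map_zero _) (map_one _), Matrix.vecMul_one]

end LagrangeSystem

end TubularLagrange

theorem mainTheorem2 (n k : ℕ) (hkn : k < n) (h : Fin k → MvPolynomial (Fin n) ℝ)
    (hne : (realZeroSet h).Nonempty)
    (hrank : ∀ x ∈ realZeroSet h, (jacobian h (fun i => x i)).rank = k) :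
    IsEmbeddedSubmanifold (n - k) (realZeroSet h) ∧
    ∃ U : Set (EuclideanSpace ℝ (Fin n)),
      IsTubularNeighborhood (realZeroSet h) U ∧
      ∀ b ∈ U, ∃ xb : EuclideanSpace ℝ (Fin n),
        IsNearestPoint (realZeroSet h) b xb ∧
        (∀ y, IsNearestPoint (realZeroSet h) b y → y = xb) ∧
        ∃ lam : Fin k → ℝ,
          IsIsolatedZero (lagrangeSystem h b) (complexPoint xb lam) ∧
          IsSimpleZero (lagrangeSystem h b) (complexPoint xb lam) ∧
          ∀ z : Fin n ⊕ Fin k → ℂ, IsComplexZero (lagrangeSystem h b) z →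
            (∀ i, z (Sum.inl i) = (xb i : ℂ)) → z = complexPoint xb lam := by
  have hsub (x : EuclideanSpace ℝ (Fin n)) (hx : constraintMap h x = 0) :
      (fderiv ℝ (constraintMap h) x).HasRightInverse :=
    hasRightInverse_fderiv_constraintMap (hrank x (constraintMap_preimage_zero.le hx))
  have hM := isEmbeddedSubmanifold_preimage_zero contDiff_constraintMap hsub
  obtain ⟨U, hU, hnear⟩ := exists_isTubularNeighborhood_preimage_zero contDiff_constraintMap hsub
  rw [constraintMap_preimage_zero] at hM hU hnear
  rw [finrank_euclideanSpace_fin] at hM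
  refine ⟨hM, U, hU, fun b hb => ?_⟩
  obtain ⟨x, hx, hunique, μ, hzero, hinv⟩ := hnear b hb
  have hsimple := isSimpleZero_complexPoint hzero hinv
  refine ⟨x, hx, hunique, μ, hsimple.isIsolatedZero, hsimple, fun z hz hzx => ?_⟩
  exact (hsimple.1.eq_of_comp_inl_eq hz (funext fun i => (hzx i).symm)
    (vecMul_injective_jacobian_algebraMap_comp (hrank x hx.1))).symm
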